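/- Let $p$ be a prime, $F$ a finite extension of $\mathbb{Q}_p$, $K$ a quadratic extension of $F$ with nontrivial $F$-automorphism $\theta$, and $L$ a quadratic extension of $K$; write $N=N_{L/K}$, $x\mapsto\bar x$ for the conjugation of $L/K$, $\eta=\eta_{L/K}$ for the character of $K^*$ of order two with kernel $N(L^*)$, and $|\cdot|_L$ for the normalized absolute value of $L$. For a continuous character $\omega:L^*\to\mathbb{C}^*$ and a nontrivial continuous unitary character $\psi$ of the additive group $K$, let $\mathcal S(L,\omega)$ be the space of locally constant compactly supported $\Phi:L\to\mathbb{C}$ with $\Phi(xy)=\omega(y)^{-1}\Phi(x)$ for all $x \in L$ and all $y\in L^*$ with $N(y)=1$. Let $GL_2(K)_+=\{h\in GL_2(K):\det h\in N(L^*)\}$, and let $r_{\omega,\psi}$ be the Weil representation of $GL_2(K)_+$ on $\mathcal S(L,\omega)$, that is, the one with $$r_{\omega,\psi}\begin{pmatrix}1&z\\0&1\end{pmatrix}\Phi(x)=\psi(zN(x))\Phi(x),\qquad r_{\omega,\psi}\begin{pmatrix}a&0\\0&a^{-1}\end{pmatrix}\Phi(x)=\eta(a)|a|_L^{1/2}\Phi(ax),$$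 $$r_{\omega,\psi}\begin{pmatrix}0&1\\-1&0\end{pmatrix}\Phi(x)=\gamma(\psi)\int_L\Phi(y)\,\psi(\mathrm{Tr}_{L/K}(\bar x y))\,dy,\qquad r_{\omega,\psi}\begin{pmatrix}N(l)&0\\0&1\end{pmatrix}\Phi(x)=|l|_L^{1/2}\omega(l)\Phi(xl)$$ for $z\in K$, $a\in K^*$, $l\in L^*$, where $dy$ is the Haar measure of $L$ self-dual for $(x,y)\mapsto\psi(\mathrm{Tr}_{L/K}(\bar xy))$ and $\gamma(\psi)$ is the Weil index of $(N,\psi)$, i.e. the value of $\int_B\psi(N(y))\,dy$ for all sufficiently large balls $B$ of $L$ centred at $0$. The dihedral representation is $\Pi(\omega)=\mathrm{Ind}_{GL_2(K)_+}^{GL_2(K)}r_{\omega,\psi}$; its isomorphism class does not depend on $\psi$. **Proposition.** Suppose that $\theta$ extends to an $F$-automorphism $\tilde\theta$ of $L$. Then for every continuous character $\omega$ of $L^*$, the representation $\Pi(\omega)^\theta=\Pi(\omega)\circ\theta$ of $GL_2(K)$, where $\theta$ acts on $GL_2(K)$ entrywise, is isomorphic to $\Pi(\omega\circ\tilde\theta)$,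 for any choice of the additive characters used to form the two sides. -/

import Mathlib

open scoped MatrixGroups
open MeasureTheory Filter

noncomputable section

namespace Dihedral

/-! Throughout, `K` and `L` are finite extensions of `ℚ_[p]` with the norms extending the `p`-adic
one, and `L` is a (quadratic) extension of `K`.  The quadratic form in play is
`N = N_{L/K} : L → K`, with polar form `(x, y) ↦ N(x + y) - N x - N y = Tr_{L/K}(x̄ y)`. -/

/-- The normalized absolute value (module) of `L`: `‖x‖ ^ [L : ℚ_p] = |N_{L/ℚ_p} x|_p`. -/
def modulus (p : ℕ) [Fact p.Prime] {L : Type*} [NormedField L] [NormedAlgebra ℚ_[p] L] (x : L) :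
    ℝ :=
  ‖x‖ ^ Module.finrank ℚ_[p] L

/-- The quadratic character `η_{L/K}` of `Kˣ`, with kernel the norms from `L`. -/
def eta {K : Type*} (L : Type*) [Field K] [Field L] [Algebra K L] (a : K) : ℂ :=
  open Classical in if ∃ l : L, Algebra.norm K l = a then 1 else -1

/-- The character `(x, y) ↦ ψ(Tr_{L/K}(x̄ y))` of `L × L`, through the polar form of the norm. -/
def pairing {K L : Type*} [Field K] [Field L] [Algebra K L] (ψ : AddChar K Circle) (x y : L) :
    Circle :=
  ψ (QuadraticMap.polar (Algebra.norm K) x y)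

section SelfDual

variable (p : ℕ) [Fact p.Prime] {K : Type*} (L : Type*) [Field K] [NormedField L]
  [NormedAlgebra ℚ_[p] L] [FiniteDimensional ℚ_[p] L] [MeasurableSpace L] [BorelSpace L]
  [Algebra K L]

/-- A Haar measure of the additive group of `L`. -/
def haarL : Measure L :=
  haveI : ProperSpace L := FiniteDimensional.proper ℚ_[p] L
  Measure.addHaar

/-- The Haar measure of `L` that is self-dual for `pairing ψ`.  With `𝓞` the unit ball and `𝓞⊥` its
annihilator, the Fourier transform for a Haar measure `μ` takes the indicator of `𝓞` to
`μ(𝓞)` times that of `𝓞⊥`, and this one to `μ(𝓞⊥)` times that of `𝓞`; so `μ` is self-dual iff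
`μ(𝓞) μ(𝓞⊥) = 1`. -/
def selfDualHaar (ψ : AddChar K Circle) : Measure L :=
  ENNReal.ofReal (√((haarL p L).real (Metric.closedBall 0 1) *
    (haarL p L).real {y : L | ∀ x ∈ Metric.closedBall (0 : L) 1, pairing ψ x y = 1}))⁻¹ • haarL p L

/-- The Weil index `γ(ψ)` of the quadratic form `N_{L/K}`: the (eventually constant) value of
`∫_B ψ(N y) dy` over large balls `B`, for the self-dual measure.  This is the constant for
which the Fourier transform of `ψ ∘ N`, as a distribution, is `γ(ψ)` times `x ↦ ψ(-N x)`. -/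
def weilIndex (ψ : AddChar K Circle) : ℂ :=
  limUnder atTop fun r : ℝ =>
    ∫ y in Metric.closedBall (0 : L) r, (ψ (Algebra.norm K y) : ℂ) ∂(selfDualHaar p L ψ)

end SelfDual

section Operators

variable (p : ℕ) [Fact p.Prime] {K L : Type*} [Field K] [NormedField L]
  [NormedAlgebra ℚ_[p] L] [FiniteDimensional ℚ_[p] L] [MeasurableSpace L] [BorelSpace L]
  [Algebra K L]

/-- The Weil representation of `SL₂(K)` attached to `(L, N_{L/K})` and `ψ`, acting on functions on
`L`: the operator of `s = (a b; c d)`.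

* If `c = 0`, it is `Φ ↦ η(a) |a|_L^{1/2} ψ(a b N x) Φ(a x)`.  This contains the two formulas
  `(1 z; 0 1) Φ (x) = ψ(z N x) Φ(x)` and `diag(a, a⁻¹) Φ (x) = η(a) |a|_L^{1/2} Φ(a x)`.
* If `c ≠ 0`, let `ψ' = ψ(-c⁻¹ ·)`.  It is
  `Φ ↦ γ(ψ') ∫ ψ'(Tr(x̄ y) - a N x - d N y) Φ(y) dy` with `dy` self-dual for `ψ'`.  For
  `s = (0 1; -1 0)` this is `γ(ψ) ∫ Φ(y) ψ(Tr(x̄ y)) dy`, and in general it is the operator of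
  `(1 a/c; 0 1) diag(-c⁻¹, -c) (0 1; -1 0) (1 d/c; 0 1) = s`, because
  `γ(ψ(α ·)) = η(α) γ(ψ)` and the self-dual measure of `ψ(α ·)` is `|α|_L^{1/2}` times that
  of `ψ`. -/
def weilSL (ψ : AddChar K Circle) (s : SL(2, K)) (Φ : L → ℂ) (x : L) : ℂ :=
  open Classical in
  if s 1 0 = 0 then
    eta L (s 0 0) * (√(modulus p (algebraMap K L (s 0 0))) : ℝ) *
      (ψ (s 0 0 * s 0 1 * Algebra.norm K x) : ℂ) * Φ (algebraMap K L (s 0 0) * x)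
  else
    weilIndex p L (ψ.mulShift (-(s 1 0)⁻¹)) *
      ∫ y : L, (ψ.mulShift (-(s 1 0)⁻¹) (QuadraticMap.polar (Algebra.norm K) x y
        - s 0 0 * Algebra.norm K x - s 1 1 * Algebra.norm K y) : ℂ) * Φ y
        ∂(selfDualHaar p L (ψ.mulShift (-(s 1 0)⁻¹)))

/-- The operator `r_{ω,ψ}(h)` for `h = diag(N l, 1) s`, `l ∈ Lˣ`, `s ∈ SL₂(K)`.  The elements of this
form make up the group `GL₂(K)₊` of matrices whose determinant is a norm from `L`.
Here `diag(N l, 1)` acts by `Φ ↦ |l|_L^{1/2} ω(l) Φ(x l)`. On the space `schwartz K ω` below the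
operator depends only on `h`. -/
def weilGL (ω : Lˣ →* ℂˣ) (ψ : AddChar K Circle) (l : Lˣ) (s : SL(2, K)) (Φ : L → ℂ) (x : L) : ℂ :=
  (√(modulus p (l : L)) : ℝ) * (ω l : ℂ) * weilSL p ψ s Φ (x * l)

theorem weilGL_smul {ω : Lˣ →* ℂˣ} {ψ : AddChar K Circle} (l : Lˣ) (s : SL(2, K)) (c : ℂ)
    (Φ : L → ℂ) : weilGL p ω ψ l s (c • Φ) = c • weilGL p ω ψ l s Φ := by
  funext x
  simp only [weilGL, weilSL, Pi.smul_apply, smul_eq_mul]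
  split_ifs
  · ring
  · simp only [mul_left_comm _ c]
    rw [integral_const_mul]
    ring

end Operators

/-- The space `S(L, ω)` of locally constant, compactly supported functions `Φ` on `L` with
`Φ(x y) = ω(y)⁻¹ Φ(x)` for all `y` of norm one. -/
def schwartz (K : Type*) {L : Type*} [Field K] [NormedField L] [Algebra K L] (ω : Lˣ →* ℂˣ) :
    Submodule ℂ (L → ℂ) where
  carrier := {Φ | IsLocallyConstant Φ ∧ HasCompactSupport Φ ∧
    ∀ (x : L) (y : Lˣ), Algebra.norm K (y : L) = 1 → Φ (x * y) = ((ω y)⁻¹ : ℂˣ) * Φ x}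
  zero_mem' := ⟨IsLocallyConstant.const 0, HasCompactSupport.zero, by simp⟩
  add_mem' := by
    rintro Φ Ψ ⟨h1, h2, h3⟩ ⟨k1, k2, k3⟩
    refine ⟨h1.add k1, h2.add k2, fun x y hy => ?_⟩
    simp only [Pi.add_apply, h3 x y hy, k3 x y hy, mul_add]
  smul_mem' := by
    rintro c Φ ⟨h1, h2, h3⟩
    refine ⟨h1.comp (fun z => c * z), h2.comp_left (g := fun z => c * z) (mul_zero c),
      fun x y hy => ?_⟩
    simp only [Pi.smul_apply, smul_eq_mul, h3 x y hy]
    ring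

/-- The matrix `diag(a, 1)` in `GL₂(K)`. -/
def diagOne {K : Type*} [Field K] (a : Kˣ) : GL (Fin 2) K where
  val := !![(a : K), 0; 0, 1]
  inv := !![((a⁻¹ : Kˣ) : K), 0; 0, 1]
  val_inv := by simp [Matrix.one_fin_two]
  inv_val := by simp [Matrix.one_fin_two]

theorem continuous_norm (p : ℕ) [Fact p.Prime] {K L : Type*} [NormedField K]
    [NormedAlgebra ℚ_[p] K] [NormedField L] [NormedAlgebra ℚ_[p] L] [FiniteDimensional ℚ_[p] L]
    [Algebra K L] [IsScalarTower ℚ_[p] K L] [FiniteDimensional K L] :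
    Continuous (Algebra.norm K : L → K) := by
  let b := Module.finBasis K L
  have h : (Algebra.norm K : L → K) = fun y => (Algebra.leftMulMatrix b y).det :=
    funext fun y => Algebra.norm_eq_matrix_det b y
  rw [h]
  refine Continuous.matrix_det (continuous_matrix fun i j => ?_)
  let f : L →ₗ[ℚ_[p]] K :=
    ((b.coord i ∘ₗ LinearMap.mulRight K (b j)) : L →ₗ[K] K).restrictScalars ℚ_[p]
  have hf : Continuous f := LinearMap.continuous_of_finiteDimensional f
  refine hf.congr fun y => ?_
  simp [f, Algebra.leftMulMatrix_eq_repr_mul]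

section Induced

variable (p : ℕ) [Fact p.Prime] {K L : Type*} [NormedField K] [NormedAlgebra ℚ_[p] K]
  [NormedField L] [NormedAlgebra ℚ_[p] L] [FiniteDimensional ℚ_[p] L]
  [Algebra K L] [IsScalarTower ℚ_[p] K L] [MeasurableSpace L] [BorelSpace L]

theorem integrable_kernel [FiniteDimensional K L] {ω : Lˣ →* ℂˣ} {ψ : AddChar K Circle}
    (hψ : Continuous ψ) (ψ' : AddChar K Circle) (α a d : K) (Φ : schwartz K ω) (x : L) :
    Integrable (fun y : L => (ψ.mulShift α (QuadraticMap.polar (Algebra.norm K) x y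
      - a * Algebra.norm K x - d * Algebra.norm K y) : ℂ) * (Φ : L → ℂ) y)
      (selfDualHaar p L ψ') := by
  have : ProperSpace L := FiniteDimensional.proper ℚ_[p] L
  have hN : Continuous (Algebra.norm K : L → K) := continuous_norm p
  refine Integrable.smul_measure ?_ ENNReal.ofReal_ne_top
  have hc : Continuous fun y : L => (ψ.mulShift α (QuadraticMap.polar (Algebra.norm K) x y
      - a * Algebra.norm K x - d * Algebra.norm K y) : ℂ) := by
    simp only [AddChar.mulShift_apply, QuadraticMap.polar]
    exact continuous_subtype_val.comp (hψ.comp (by fun_prop))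
  unfold haarL
  exact (hc.mul Φ.2.1.continuous).integrable_of_hasCompactSupport Φ.2.2.1.mul_left

theorem weilGL_add [FiniteDimensional K L] {ω : Lˣ →* ℂˣ} {ψ : AddChar K Circle}
    (hψ : Continuous ψ) (l : Lˣ) (s : SL(2, K)) (Φ Ψ : schwartz K ω) :
    weilGL p ω ψ l s (Φ + Ψ : L → ℂ) = weilGL p ω ψ l s Φ + weilGL p ω ψ l s Ψ := by
  funext x
  simp only [weilGL, weilSL, Pi.add_apply]
  split_ifs
  · ring
  · simp only [mul_add]
    rw [integral_add (integrable_kernel p hψ _ _ _ _ Φ _) (integrable_kernel p hψ _ _ _ _ Ψ _)]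
    ring

/-- The space of the representation of `GL₂(K)` induced from the representation `r_{ω,ψ}` of the
open subgroup `GL₂(K)₊` of index two on `S(L, ω)`: the functions `f : GL₂(K) → S(L, ω)` with
`f(h g) = r_{ω,ψ}(h) f(g)` for `h ∈ GL₂(K)₊`.  The subgroup being open of finite index and `r_{ω,ψ}`
smooth, no condition of smoothness or support has to be added. -/
def space [FiniteDimensional K L] (ω : Lˣ →* ℂˣ) (ψ : AddChar K Circle) (hψ : Continuous ψ) :
    Submodule ℂ (GL (Fin 2) K → schwartz K ω) where
  carrier := {f | ∀ (l : Lˣ) (s : SL(2, K)) (g : GL (Fin 2) K),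
    (f (diagOne (Units.map (Algebra.norm K) l) * (s : GL (Fin 2) K) * g) : L → ℂ) =
      weilGL p ω ψ l s (f g)}
  zero_mem' := fun l s g => by
    have := weilGL_smul p (ω := ω) (ψ := ψ) l s 0 (0 : L → ℂ)
    simpa using this.symm
  add_mem' := fun {f₁ f₂} h₁ h₂ l s g => by
    simp only [Pi.add_apply, Submodule.coe_add, weilGL_add p hψ, ← h₁ l s g, ← h₂ l s g]
  smul_mem' := fun c f h l s g => by
    simp only [Pi.smul_apply, Submodule.coe_smul, weilGL_smul, ← h l s g]

/-- The dihedral representation `Π(ω)` of `GL₂(K)`, formed with the additive character `ψ` of `K`: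
`GL₂(K)` acts by right translation on the space induced from `r_{ω,ψ}`. -/
def rep [FiniteDimensional K L] (ω : Lˣ →* ℂˣ) (ψ : AddChar K Circle) (hψ : Continuous ψ) :
    Representation ℂ (GL (Fin 2) K) (space p ω ψ hψ) where
  toFun g₀ :=
    { toFun := fun f => ⟨fun g => f.1 (g * g₀), fun l s g => by
        simpa only [mul_assoc] using f.2 l s (g * g₀)⟩
      map_add' := fun _ _ => rfl
      map_smul' := fun _ _ => rfl }
  map_one' := by ext f; simp
  map_mul' g₀ g₁ := by ext f; simp [mul_assoc]

end Induced

end Dihedral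

end

/-! The proof transports structure along `θt`, then changes the additive character.

An automorphism σ of L extending θ respects everything the Weil representation is built from. It is
an isometry, since it is bounded and multiplicative. It therefore preserves balls and Haar measure,
and N(σx) = θ(N x). Hence precomposition with σ carries r_{ω,ψ}(θ(h)) to r_{ω∘σ,ψ∘θ}(h)
(`weilGL_comp`), and f ↦ (g ↦ f(θ(g)) ∘ σ) identifies Π(ω)^θ formed with ψ with Π(ω∘σ) formed with
ψ∘θ (`repEquivComp`).

To reach an arbitrary second character, self-duality of K (`AddChar.exists_eq_mulShift`) writes it
as (ψ∘θ)(α ·) with α ≠ 0. Conjugation by diag(α, 1) changes r_{ω,ψ} into r_{ω,ψ(α ·)}, so left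
translation by this matrix identifies the two induced spaces (`repEquivMulShift`). Self-duality
comes from counting characters of finite quotients of balls, followed by compactness. -/

noncomputable section

/-! ### Finite duality, and small subgroups of the circle -/

namespace AddChar

/-- A subgroup of the dual of a finite abelian group that separates points is the whole dual. -/
theorem subgroup_eq_top_of_separating {G : Type*} [AddCommGroup G] [Finite G]
    (S : Subgroup (AddChar G Circle)) (hS : ∀ x : G, (∀ χ ∈ S, χ x = 1) → x = 0) : S = ⊤ := by
  have hcard : Nat.card (AddChar G Circle) = Nat.card G := by
    have := Fintype.ofFinite G
    rw [Nat.card_congr (circleEquivComplex (α := G)).toEquiv, Nat.card_eq_fintype_card, card_eq,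
      Nat.card_eq_fintype_card]
  have : Finite (AddChar G Circle) := Finite.of_equiv _ (circleEquivComplex (α := G)).symm.toEquiv
  have := Fintype.ofFinite (Additive S)
  let ev : G → AddChar (Additive S) ℂ := fun x =>
    { toFun := fun χ => ((χ.toMul : AddChar G Circle) x : ℂ)
      map_zero_eq_one' := by simp
      map_add_eq_mul' := fun χ χ' => by simp [AddChar.mul_apply] }
  have hev : Function.Injective ev := by
    intro x y hxy
    refine sub_eq_zero.1 (hS _ fun χ hχ => ?_)
    have h : (χ x : ℂ) = χ y :=
      DFunLike.congr_fun hxy (Additive.ofMul (⟨χ, hχ⟩ : S))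
    rw [map_sub_eq_div, Circle.ext h, div_self']
  -- Separation embeds G in the dual of S, which has as many elements as S; the dual of G has as
  -- many as G.
  have hle : Nat.card G ≤ Nat.card S := by
    refine (Nat.card_le_card_of_injective ev hev).trans_eq ?_
    rw [Nat.card_eq_fintype_card, card_eq, ← Nat.card_eq_fintype_card]
    rfl
  exact Subgroup.eq_top_of_le_card S (hcard.trans_le hle)

/-- If a group `S` of characters of `A` has the finite index subgroup `C` as its annihilator, then
it contains all characters that are trivial on `C`. -/
theorem mem_of_separating {A : Type*} [AddCommGroup A] (C : AddSubgroup A) [Finite (A ⧸ C)]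
    (S : Subgroup (AddChar A Circle)) (hS : ∀ χ ∈ S, ∀ x ∈ C, χ x = 1)
    (hsep : ∀ x : A, (∀ χ ∈ S, χ x = 1) → x ∈ C)
    (χ : AddChar A Circle) (hχ : ∀ x ∈ C, χ x = 1) : χ ∈ S := by
  have lift : ∀ χ : AddChar A Circle, (∀ x ∈ C, χ x = 1) →
      ∃ χ' : AddChar (A ⧸ C) Circle, χ'.compAddMonoidHom (QuotientAddGroup.mk' C) = χ := by
    intro χ h
    refine ⟨toAddMonoidHomEquiv.symm (QuotientAddGroup.lift C (toAddMonoidHomEquiv χ) ?_), ?_⟩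
    · intro x hx
      exact congrArg Additive.ofMul (h x hx)
    · ext x
      rfl
  let S' : Subgroup (AddChar (A ⧸ C) Circle) :=
    { carrier := {χ | χ.compAddMonoidHom (QuotientAddGroup.mk' C) ∈ S}
      one_mem' := S.one_mem
      mul_mem' := fun h h' => S.mul_mem h h'
      inv_mem' := fun {χ} h => by
        have hinv : χ⁻¹.compAddMonoidHom (QuotientAddGroup.mk' C) =
            (χ.compAddMonoidHom (QuotientAddGroup.mk' C))⁻¹ := by
          ext x
          simp [inv_apply]
        rw [Set.mem_ofPred_eq, hinv]
        exact S.inv_mem h }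
  have htop : S' = ⊤ := by
    refine subgroup_eq_top_of_separating S' fun x => ?_
    refine QuotientAddGroup.induction_on x fun a ha => ?_
    rw [QuotientAddGroup.eq_zero_iff]
    refine hsep a fun χ hχ => ?_
    obtain ⟨χ', rfl⟩ := lift χ (hS χ hχ)
    exact ha χ' hχ
  obtain ⟨χ', rfl⟩ := lift χ hχ
  exact (htop ▸ Subgroup.mem_top χ' : χ' ∈ S')

end AddChar

/-- The circle has no small subgroups. -/
theorem Circle.eq_one_of_forall_norm_pow_sub_one_le (z : Circle)
    (h : ∀ n : ℕ, ‖((z ^ n : Circle) : ℂ) - 1‖ ≤ 1 / 2) : z = 1 := by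
  by_contra hz
  have hpos : 0 < ‖(z : ℂ) - 1‖ := by
    rw [norm_pos_iff, sub_ne_zero]
    exact fun h => hz (Circle.ext h)
  -- Squaring multiplies the distance of w to 1 by |w + 1|, at least 3/2 while |w - 1| ≤ 1/2;
  -- unbounded growth is absurd.
  have key : ∀ k : ℕ, (3 / 2 : ℝ) ^ k * ‖(z : ℂ) - 1‖ ≤ ‖((z ^ (2 ^ k) : Circle) : ℂ) - 1‖ := by
    intro k
    induction k with
    | zero => simp
    | succ k ih =>
      set w : ℂ := ((z ^ (2 ^ k) : Circle) : ℂ) with hw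
      have h1 : ((z ^ (2 ^ (k + 1)) : Circle) : ℂ) - 1 = (w + 1) * (w - 1) := by
        rw [pow_succ 2 k, pow_mul, Circle.coe_pow, ← hw]; ring
      have h2 : (3 / 2 : ℝ) ≤ ‖w + 1‖ := by
        have h3 := norm_sub_norm_le (2 : ℂ) (1 - w)
        have h4 : ‖(1 : ℂ) - w‖ ≤ 1 / 2 := by rw [norm_sub_rev]; exact h _
        have h5 : (2 : ℂ) - (1 - w) = w + 1 := by ring
        rw [h5, Complex.norm_ofNat] at h3
        linarith
      rw [h1, norm_mul, pow_succ']
      calc (3 / 2 : ℝ) * (3 / 2) ^ k * ‖(z : ℂ) - 1‖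
          = 3 / 2 * ((3 / 2) ^ k * ‖(z : ℂ) - 1‖) := by ring
        _ ≤ _ := by gcongr
  obtain ⟨k, hk⟩ := pow_unbounded_of_one_lt (1 / 2 / ‖(z : ℂ) - 1‖) (by norm_num : (1 : ℝ) < 3 / 2)
  rw [div_lt_iff₀ hpos] at hk
  exact absurd (hk.trans_le (key k)) (not_lt.2 (h _))

/-! ### Self-duality of a nonarchimedean local field -/

section LocalField

variable {K : Type*} [NormedField K] [IsUltrametricDist K]

/-- By the ultrametric inequality, multiples of a point of a small ball stay in it. All powers of
its image are then within 1/2 of 1, which forces the image to be 1. -/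
theorem AddChar.exists_ne_zero_trivial_on_ball (hK : ∃ x : K, 1 < ‖x‖) {ψ : AddChar K Circle}
    (hψ : Continuous ψ) : ∃ c : K, c ≠ 0 ∧ ∀ x, ‖x‖ ≤ ‖c‖ → ψ x = 1 := by
  have hc : Continuous fun x => ((ψ x : Circle) : ℂ) := continuous_subtype_val.comp hψ
  obtain ⟨ρ, hρ, h⟩ := Metric.continuousAt_iff.1 (hc.continuousAt (x := 0)) (1 / 2) (by norm_num)
  obtain ⟨t, ht⟩ := hK
  have ht0 : 0 < ‖t‖ := one_pos.trans ht
  obtain ⟨n, hn⟩ := exists_pow_lt_of_lt_one hρ (inv_lt_one_of_one_lt₀ ht)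
  refine ⟨t⁻¹ ^ n, pow_ne_zero _ (inv_ne_zero (norm_pos_iff.1 ht0)), fun x hx => ?_⟩
  refine Circle.eq_one_of_forall_norm_pow_sub_one_le _ fun m => ?_
  have hmx : dist (m • x) 0 < ρ := by
    rw [dist_zero_right, nsmul_eq_mul, norm_mul]
    calc ‖(m : K)‖ * ‖x‖ ≤ 1 * ‖x‖ := by
          gcongr; exact IsUltrametricDist.norm_natCast_le_one K m
      _ ≤ ‖t⁻¹ ^ n‖ := by rwa [one_mul]
      _ < ρ := by rwa [norm_pow, norm_inv]
  have := h hmx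
  rw [AddChar.map_nsmul_eq_pow, AddChar.map_zero_eq_one, Circle.coe_one, dist_eq_norm] at this
  exact this.le

/-- If multiplication by `u` preserves the annihilator of the unit ball, then `u` is integral. -/
theorem AddChar.norm_le_one_of_mul_mem_annihilator (hK : ∃ x : K, 1 < ‖x‖) {ψ : AddChar K Circle}
    (hψ : Continuous ψ) (hψ' : ψ ≠ 1) (u : K)
    (hu : ∀ d : K, (∀ o : K, ‖o‖ ≤ 1 → ψ (o * d) = 1) → ∀ o : K, ‖o‖ ≤ 1 → ψ (o * (u * d)) = 1) :
    ‖u‖ ≤ 1 := by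
  by_contra! h
  obtain ⟨c, hc, hc'⟩ := exists_ne_zero_trivial_on_ball hK hψ
  -- The annihilator contains some c ≠ 0, hence all uⁿc. If ‖u‖ > 1, the multiples of these by
  -- integral elements exhaust K and ψ is trivial.
  have key : ∀ n : ℕ, ∀ o : K, ‖o‖ ≤ 1 → ψ (o * (u ^ n * c)) = 1 := by
    intro n
    induction n with
    | zero =>
      intro o ho
      refine hc' _ ?_
      rw [pow_zero, one_mul, norm_mul]
      exact mul_le_of_le_one_left (norm_nonneg _) ho
    | succ n ih =>
      rw [pow_succ', mul_assoc]
      exact hu _ ih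
  refine hψ' (DFunLike.ext _ _ fun x => ?_)
  obtain ⟨n, hn⟩ := pow_unbounded_of_one_lt (‖x‖ / ‖c‖) h
  have hne : u ^ n * c ≠ 0 :=
    mul_ne_zero (pow_ne_zero _ (norm_pos_iff.1 (one_pos.trans h))) hc
  have := key n (x / (u ^ n * c)) ?_
  · rwa [div_mul_cancel₀ _ hne] at this
  · rw [norm_div, div_le_one (norm_pos_iff.2 hne), norm_mul, norm_pow]
    exact ((div_lt_iff₀ (norm_pos_iff.2 hc)).1 hn).le

/-- A point outside of a ball is separated from it by some shift of a nontrivial character. -/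
theorem AddChar.norm_le_of_forall_shift (hK : ∃ x : K, 1 < ‖x‖) {ψ : AddChar K Circle}
    (hψ : Continuous ψ) (hψ' : ψ ≠ 1) {c : K} (hc : c ≠ 0) (x : K)
    (hx : ∀ α : K, (∀ y : K, ‖y‖ ≤ ‖c‖ → ψ (α * y) = 1) → ψ (α * x) = 1) : ‖x‖ ≤ ‖c‖ := by
  have h : ‖x / c‖ ≤ 1 := by
    refine norm_le_one_of_mul_mem_annihilator hK hψ hψ' _ fun d hd o ho => ?_
    have : o * (x / c * d) = o * d / c * x := by ring
    rw [this]
    refine hx _ fun y hy => ?_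
    have : o * d / c * y = o * (y / c) * d := by ring
    rw [this]
    refine hd _ ?_
    rw [norm_mul, norm_div]
    exact mul_le_one₀ ho (by positivity) (div_le_one_of_le₀ hy (norm_nonneg _))
  rwa [norm_div, div_le_one (norm_pos_iff.2 hc)] at h

/-- On a ball, each continuous character is a shift of a given nontrivial one. -/
theorem AddChar.exists_eq_mulShift_on_ball [ProperSpace K] (hK : ∃ x : K, 1 < ‖x‖)
    {ψ ψ' : AddChar K Circle} (hψ : Continuous ψ) (hψ' : ψ ≠ 1) {c : K} (hc : c ≠ 0)
    (hψc : ∀ x, ‖x‖ ≤ ‖c‖ → ψ' x = 1) {r : ℝ} (hr : 0 < r) :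
    ∃ α : K, (∀ y, ‖y‖ ≤ ‖c‖ → ψ (α * y) = 1) ∧ ∀ x, ‖x‖ ≤ r → ψ' x = ψ (α * x) := by
  have hc0 : 0 < ‖c‖ := norm_pos_iff.2 hc
  let B : AddSubgroup K := (IsUltrametricDist.closedBall_openAddSubgroup K hr).toAddSubgroup
  have hB : ∀ x, x ∈ B ↔ ‖x‖ ≤ r := fun x => mem_closedBall_zero_iff
  let C₀ : OpenAddSubgroup K := IsUltrametricDist.closedBall_openAddSubgroup K hc0
  have hC₀ : ∀ x, x ∈ C₀ ↔ ‖x‖ ≤ ‖c‖ := fun x => mem_closedBall_zero_iff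
  let C : AddSubgroup B := C₀.toAddSubgroup.addSubgroupOf B
  have hC : ∀ x : B, x ∈ C ↔ ‖(x : K)‖ ≤ ‖c‖ := fun x => mem_closedBall_zero_iff
  have : CompactSpace B := isCompact_iff_compactSpace.1 (isCompact_closedBall (0 : K) r)
  have : Finite (B ⧸ C) :=
    AddSubgroup.quotient_finite_of_isOpen C (C₀.isOpen.preimage continuous_subtype_val)
  let res : K → AddChar B Circle := fun α => (ψ.mulShift α).compAddMonoidHom B.subtype
  have hres : ∀ α (x : B), res α x = ψ (α * x) := fun α x => rfl
  -- The shifts of ψ that are trivial on the ball of radius ‖c‖, restricted to B. Their common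
  -- kernel is C, so by finite duality they are all the characters of B / C.
  let S : Subgroup (AddChar B Circle) :=
    { carrier := {χ | ∃ α, (∀ y, ‖y‖ ≤ ‖c‖ → ψ (α * y) = 1) ∧ χ = res α}
      one_mem' := ⟨0, by simp, by ext; simp [hres]⟩
      mul_mem' := by
        rintro _ _ ⟨α, hα, rfl⟩ ⟨β, hβ, rfl⟩
        refine ⟨α + β, fun y hy => ?_, DFunLike.ext _ _ fun x => ?_⟩
        · rw [add_mul, map_add_eq_mul, hα y hy, hβ y hy, one_mul]
        · rw [mul_apply, hres, hres, hres, add_mul, map_add_eq_mul]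
      inv_mem' := by
        rintro _ ⟨α, hα, rfl⟩
        refine ⟨-α, fun y hy => ?_, DFunLike.ext _ _ fun x => ?_⟩
        · rw [neg_mul, map_neg_eq_inv, hα y hy, inv_one]
        · rw [inv_apply, hres, hres, neg_mul, NegMemClass.coe_neg, mul_neg] }
  have hmem : ψ'.compAddMonoidHom B.subtype ∈ S := by
    refine mem_of_separating C S ?_ ?_ _ fun x hx => hψc _ ((hC x).1 hx)
    · rintro _ ⟨α, hα, rfl⟩ x hx
      exact hα _ ((hC x).1 hx)
    · intro x hx
      rw [hC]
      exact norm_le_of_forall_shift hK hψ hψ' hc _ fun α hα => hx _ ⟨α, hα, rfl⟩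
  obtain ⟨α, hα, h⟩ := hmem
  exact ⟨α, hα, fun x hx => DFunLike.congr_fun h (⟨x, (hB x).2 hx⟩ : B)⟩

/-- Self-duality of a local field: each continuous character is a shift of a given nontrivial
one. -/
theorem AddChar.exists_eq_mulShift [ProperSpace K] (hK : ∃ x : K, 1 < ‖x‖)
    {ψ ψ' : AddChar K Circle} (hψ : Continuous ψ) (hψ1 : ψ ≠ 1) (hψ' : Continuous ψ') :
    ∃ α : K, ψ' = ψ.mulShift α := by
  obtain ⟨c, hc, hψc⟩ := exists_ne_zero_trivial_on_ball hK hψ'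
  have hc0 : 0 < ‖c‖ := norm_pos_iff.2 hc
  obtain ⟨x₀, hx₀⟩ : ∃ x₀, ψ x₀ ≠ 1 := by
    by_contra! h
    exact hψ1 (DFunLike.ext _ _ h)
  -- The shifts that work on the ball of radius n + 1 (positive also for n = 0) form a decreasing
  -- sequence of compact sets; a common point works everywhere.
  let A : ℕ → Set K := fun n =>
    Metric.closedBall 0 (‖x₀‖ / ‖c‖) ∩ {α | ∀ x, ‖x‖ ≤ n + 1 → ψ' x = ψ (α * x)}
  have hclosed : ∀ n, IsClosed (A n) := by
    intro n
    refine Metric.isClosed_closedBall.inter ?_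
    simp only [Set.ofPred_forall]
    exact isClosed_iInter fun x => isClosed_iInter fun _ =>
      isClosed_eq continuous_const (hψ.comp (continuous_mul_const x))
  have hne : ∀ n, (A n).Nonempty := by
    intro n
    obtain ⟨α, hα, h⟩ := exists_eq_mulShift_on_ball hK hψ hψ1 hc hψc
      (by positivity : (0 : ℝ) < n + 1)
    refine ⟨α, ?_, h⟩
    rw [mem_closedBall_zero_iff, le_div_iff₀ hc0]
    -- If ‖α c‖ > ‖x₀‖, then x₀ / α lies in the ball of radius ‖c‖, where ψ(α ·) is trivial,
    -- contradicting ψ(x₀) ≠ 1.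
    by_contra! hlt
    rw [← norm_mul] at hlt
    have hne : α * c ≠ 0 := norm_pos_iff.1 ((norm_nonneg _).trans_lt hlt)
    refine hx₀ ?_
    have := hα (x₀ / α) ?_
    · rwa [mul_div_cancel₀ _ (left_ne_zero_of_mul hne)] at this
    · rw [norm_div, div_le_iff₀ (norm_pos_iff.2 (left_ne_zero_of_mul hne)), ← norm_mul, mul_comm c]
      exact hlt.le
  obtain ⟨α, hα⟩ := IsCompact.nonempty_iInter_of_sequence_nonempty_isCompact_isClosed A
    (fun n => Set.inter_subset_inter_right _ fun α h x hx => h x (hx.trans (by push_cast; linarith)))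
    hne ((isCompact_closedBall _ _).of_isClosed_subset (hclosed 0) Set.inter_subset_left) hclosed
  refine ⟨α, DFunLike.ext _ _ fun x => ?_⟩
  obtain ⟨n, hn⟩ := exists_nat_ge ‖x‖
  exact (Set.mem_iInter.1 hα n).2 x (hn.trans (by linarith))

end LocalField

/-! ### Invariance of the Weil representation under automorphisms -/

namespace Dihedral

/-- Automorphisms of a finite extension of `ℚ_[p]` are isometries. -/
theorem norm_algEquiv_apply {p : ℕ} [Fact p.Prime] {L : Type*} [NormedField L]
    [NormedAlgebra ℚ_[p] L] [FiniteDimensional ℚ_[p] L] (σ : L ≃ₐ[ℚ_[p]] L) (x : L) :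
    ‖σ x‖ = ‖x‖ := by
  have hle : ∀ (τ : L ≃ₐ[ℚ_[p]] L) (x : L), ‖τ x‖ ≤ ‖x‖ := by
    intro τ x
    let T : L →L[ℚ_[p]] L := LinearMap.toContinuousLinearMap (τ.toLinearEquiv : L →ₗ[ℚ_[p]] L)
    have hT : ∀ y, ‖τ y‖ ≤ ‖T‖ * ‖y‖ := T.le_opNorm
    by_contra! hlt
    have hx : 0 < ‖x‖ := by
      rcases (norm_nonneg x).eq_or_lt with h | h
      · rw [norm_eq_zero.1 h.symm, map_zero] at hlt
        exact absurd hlt (lt_irrefl _)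
      · exact h
    -- Boundedness at xⁿ gives (‖τ x‖ / ‖x‖)ⁿ ≤ ‖T‖ for all n, so the ratio cannot exceed 1.
    obtain ⟨n, hn⟩ := pow_unbounded_of_one_lt ‖T‖ ((one_lt_div hx).2 hlt)
    rw [div_pow, lt_div_iff₀ (pow_pos hx n), ← norm_pow, ← norm_pow, ← map_pow] at hn
    exact absurd (hT _) (not_le.2 hn)
  refine le_antisymm (hle σ x) ?_
  simpa using hle σ.symm (σ x)

section Transport

variable {p : ℕ} [Fact p.Prime] {K L : Type*}
  [NormedField L] [NormedAlgebra ℚ_[p] L] [FiniteDimensional ℚ_[p] L]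

/-- An automorphism of a finite extension of `ℚ_[p]`, as a homeomorphism. -/
def algEquivHomeomorph (σ : L ≃ₐ[ℚ_[p]] L) : L ≃ₜ L :=
  (IsometryEquiv.mk σ.toEquiv
    (AddMonoidHomClass.isometry_of_norm σ (norm_algEquiv_apply σ))).toHomeomorph

theorem preimage_closedBall (σ : L ≃ₐ[ℚ_[p]] L) (r : ℝ) :
    σ ⁻¹' Metric.closedBall 0 r = Metric.closedBall 0 r := by
  ext x
  simp [norm_algEquiv_apply]

section Measure

variable [MeasurableSpace L] [BorelSpace L]

/-- The image measure is again Haar, so a multiple of the original; the factor is 1 because σ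
preserves the unit ball. -/
theorem measurePreserving_haarL (σ : L ≃ₐ[ℚ_[p]] L) :
    MeasurePreserving σ (haarL p L) (haarL p L) := by
  have : ProperSpace L := FiniteDimensional.proper ℚ_[p] L
  have hσ : Continuous σ := (algEquivHomeomorph σ).continuous
  refine ⟨hσ.measurable, ?_⟩
  have : (haarL p L).IsAddHaarMeasure := by unfold haarL; infer_instance
  have : ((haarL p L).map σ).IsAddHaarMeasure :=
    σ.toAddEquiv.isAddHaarMeasure_map (haarL p L) hσ (algEquivHomeomorph σ).symm.continuous
  have h := Measure.isAddLeftInvariant_eq_smul ((haarL p L).map σ) (haarL p L)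
  set c := Measure.addHaarScalarFactor ((haarL p L).map σ) (haarL p L)
  have h1 : (haarL p L).map σ (Metric.closedBall 0 1) = c • haarL p L (Metric.closedBall 0 1) := by
    rw [h]; rfl
  rw [Measure.map_apply hσ.measurable measurableSet_closedBall, preimage_closedBall,
    ENNReal.smul_def, smul_eq_mul] at h1
  have hpos : haarL p L (Metric.closedBall 0 1) ≠ 0 :=
    (Metric.measure_closedBall_pos _ _ one_pos).ne'
  have hfin : haarL p L (Metric.closedBall 0 1) ≠ ⊤ :=
    (isCompact_closedBall _ _).measure_lt_top.ne
  have hc : (c : ENNReal) = 1 := by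
    refine (ENNReal.mul_left_inj hpos hfin).1 ?_
    rw [one_mul, ← h1]
  rw [h, ENNReal.coe_eq_one.1 hc, one_smul]

end Measure

variable [Field K] [Algebra K L]

theorem algebraNorm_algEquiv {θ : K ≃+* K} {σ : L ≃ₐ[ℚ_[p]] L}
    (h : ∀ x : K, σ (algebraMap K L x) = algebraMap K L (θ x)) (x : L) :
    Algebra.norm K (σ x) = θ (Algebra.norm K x) := by
  have := Algebra.norm_eq_of_equiv_equiv θ σ.toRingEquiv (RingHom.ext fun x => (h x).symm) x
  rw [this, RingEquiv.apply_symm_apply]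
  rfl

theorem polar_norm_algEquiv {θ : K ≃+* K} {σ : L ≃ₐ[ℚ_[p]] L}
    (h : ∀ x : K, σ (algebraMap K L x) = algebraMap K L (θ x)) (x y : L) :
    QuadraticMap.polar (Algebra.norm K) (σ x) (σ y) =
      θ (QuadraticMap.polar (Algebra.norm K) x y) := by
  simp only [QuadraticMap.polar, ← map_add, algebraNorm_algEquiv h, map_sub]

theorem eta_ringEquiv {θ : K ≃+* K} {σ : L ≃ₐ[ℚ_[p]] L}
    (h : ∀ x : K, σ (algebraMap K L x) = algebraMap K L (θ x)) (a : K) :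
    eta L (θ a) = eta L a := by
  have : (∃ l : L, Algebra.norm K l = θ a) ↔ ∃ l : L, Algebra.norm K l = a := by
    rw [σ.surjective.exists]
    simp only [algebraNorm_algEquiv h, θ.injective.eq_iff]
  unfold eta
  congr 1
  exact propext this

section Measure

variable [MeasurableSpace L] [BorelSpace L]

/-- The annihilator of the unit ball for χ' is the preimage under σ of the one for χ, so both have
the same volume and the normalizing factors agree. -/
theorem selfDualHaar_comp {θ : K ≃+* K} {σ : L ≃ₐ[ℚ_[p]] L}
    (h : ∀ x : K, σ (algebraMap K L x) = algebraMap K L (θ x)) {χ χ' : AddChar K Circle}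
    (hχ : ∀ a, χ' a = χ (θ a)) : selfDualHaar p L χ' = selfDualHaar p L χ := by
  have hset : {y : L | ∀ x ∈ Metric.closedBall (0 : L) 1, pairing χ' x y = 1} =
      σ ⁻¹' {y : L | ∀ x ∈ Metric.closedBall (0 : L) 1, pairing χ x y = 1} := by
    ext y
    simp only [Set.mem_ofPred_eq, Set.mem_preimage, pairing]
    simp only [mem_closedBall_zero_iff, hχ, ← polar_norm_algEquiv h]
    conv_rhs => rw [σ.surjective.forall]
    simp only [norm_algEquiv_apply]
  have hmeas : (haarL p L).real {y : L | ∀ x ∈ Metric.closedBall (0 : L) 1, pairing χ' x y = 1} =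
      (haarL p L).real {y : L | ∀ x ∈ Metric.closedBall (0 : L) 1, pairing χ x y = 1} := by
    rw [hset, measureReal_def, (measurePreserving_haarL σ).measure_preimage_emb
      (algEquivHomeomorph σ).measurableEmbedding, measureReal_def]
  rw [selfDualHaar, hmeas, selfDualHaar]

theorem measurePreserving_selfDualHaar {θ : K ≃+* K} {σ : L ≃ₐ[ℚ_[p]] L}
    (h : ∀ x : K, σ (algebraMap K L x) = algebraMap K L (θ x)) {χ χ' : AddChar K Circle}
    (hχ : ∀ a, χ' a = χ (θ a)) :
    MeasurePreserving σ (selfDualHaar p L χ') (selfDualHaar p L χ) := by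
  rw [selfDualHaar_comp h hχ]
  exact (measurePreserving_haarL σ).smul_measure _

/-- The integrals agree over each ball, by the substitution y ↦ σ y, so no convergence is needed. -/
theorem weilIndex_comp {θ : K ≃+* K} {σ : L ≃ₐ[ℚ_[p]] L}
    (h : ∀ x : K, σ (algebraMap K L x) = algebraMap K L (θ x)) {χ χ' : AddChar K Circle}
    (hχ : ∀ a, χ' a = χ (θ a)) : weilIndex p L χ' = weilIndex p L χ := by
  unfold weilIndex
  congr 1
  funext r
  rw [← (measurePreserving_selfDualHaar h hχ).setIntegral_preimage_emb
    (algEquivHomeomorph σ).measurableEmbedding, preimage_closedBall]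
  simp only [algebraNorm_algEquiv h, hχ]

/-- When the lower left entry is nonzero, this is the substitution y ↦ σ y in the integral; as σ is
a measurable embedding, Φ need not be integrable. -/
theorem weilSL_comp {θ : K ≃+* K} {σ : L ≃ₐ[ℚ_[p]] L}
    (h : ∀ x : K, σ (algebraMap K L x) = algebraMap K L (θ x)) (ψ : AddChar K Circle)
    (s : SL(2, K)) (Φ : L → ℂ) (x : L) :
    weilSL p ψ (Matrix.SpecialLinearGroup.map (θ : K →+* K) s) Φ (σ x) =
      weilSL p (ψ.compAddMonoidHom (θ : K →+ K)) s (Φ ∘ σ) x := by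
  have hs : ∀ i j, Matrix.SpecialLinearGroup.map (θ : K →+* K) s i j = θ (s i j) :=
    fun i j => rfl
  have hψ : ∀ a, ψ.compAddMonoidHom (θ : K →+ K) a = ψ (θ a) := fun a => rfl
  by_cases h0 : s 1 0 = 0
  · rw [weilSL, weilSL, if_pos h0, if_pos (by rw [hs, h0, map_zero])]
    simp only [hs, Function.comp_apply]
    simp only [eta_ringEquiv h, hψ, ← h, map_mul, algebraNorm_algEquiv h, modulus,
      norm_algEquiv_apply]
  · have hχ : ∀ a, (ψ.compAddMonoidHom (θ : K →+ K)).mulShift (-(s 1 0)⁻¹) a =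
        ψ.mulShift (-(θ (s 1 0))⁻¹) (θ a) := fun a => by
      simp only [AddChar.mulShift_apply, hψ, map_mul, map_neg, map_inv₀]
    rw [weilSL, weilSL, if_neg h0, if_neg (by rwa [hs, map_eq_zero])]
    simp only [hs, Function.comp_apply]
    rw [weilIndex_comp h hχ, ← (measurePreserving_selfDualHaar h hχ).integral_comp
      (algEquivHomeomorph σ).measurableEmbedding]
    simp only [hχ, map_sub, map_mul, polar_norm_algEquiv h, algebraNorm_algEquiv h]

theorem weilGL_comp {θ : K ≃+* K} {σ : L ≃ₐ[ℚ_[p]] L}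
    (h : ∀ x : K, σ (algebraMap K L x) = algebraMap K L (θ x)) (ω : Lˣ →* ℂˣ)
    (ψ : AddChar K Circle) (l : Lˣ) (s : SL(2, K)) (Φ : L → ℂ) :
    weilGL p ω ψ (Units.map (σ : L →* L) l) (Matrix.SpecialLinearGroup.map (θ : K →+* K) s) Φ ∘ σ =
      weilGL p (ω.comp (Units.map (σ : L →* L))) (ψ.compAddMonoidHom (θ : K →+ K)) l s
        (Φ ∘ σ) := by
  funext x
  have hl : ((Units.map (σ : L →* L) l : Lˣ) : L) = σ l := rfl
  simp only [Function.comp_apply, weilGL, hl, ← map_mul, weilSL_comp h, modulus,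
    norm_algEquiv_apply, MonoidHom.comp_apply]

end Measure

/-- Composition with `σ`, as an isomorphism of spaces of Schwartz functions. -/
def schwartzComp {θ : K ≃+* K} {σ : L ≃ₐ[ℚ_[p]] L}
    (h : ∀ x : K, σ (algebraMap K L x) = algebraMap K L (θ x)) (ω : Lˣ →* ℂˣ) :
    schwartz K ω ≃ₗ[ℂ] schwartz K (ω.comp (Units.map (σ : L →* L))) where
  toFun Φ := ⟨Φ.1 ∘ σ, Φ.2.1.comp_continuous (algEquivHomeomorph σ).continuous,
    Φ.2.2.1.comp_homeomorph (algEquivHomeomorph σ), fun x y hy => by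
      have := Φ.2.2.2 (σ x) (Units.map (σ : L →* L) y)
        (by rw [Units.coe_map, MonoidHom.coe_coe, algebraNorm_algEquiv h, hy, map_one])
      simpa using this⟩
  invFun Φ := ⟨Φ.1 ∘ σ.symm, Φ.2.1.comp_continuous (algEquivHomeomorph σ).symm.continuous,
    Φ.2.2.1.comp_homeomorph (algEquivHomeomorph σ).symm, fun x y hy => by
      have hy' : Units.map (σ : L →* L) (Units.map (σ.symm : L →* L) y) = y := by
        ext; simp
      have := Φ.2.2.2 (σ.symm x) (Units.map (σ.symm : L →* L) y)
        (θ.injective (by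
          rw [← algebraNorm_algEquiv h, map_one, Units.coe_map, MonoidHom.coe_coe,
            AlgEquiv.apply_symm_apply, hy]))
      rw [MonoidHom.comp_apply, hy'] at this
      simpa using this⟩
  left_inv Φ := by ext; simp
  right_inv Φ := by ext; simp
  map_add' _ _ := rfl
  map_smul' _ _ := rfl

end Transport

/-! ### Matrix identities for θ and for conjugation by diag(α, 1) -/

theorem map_diagOne {K : Type*} [Field K] (θ : K ≃+* K) (a : Kˣ) :
    Matrix.GeneralLinearGroup.map (θ : K →+* K) (diagOne a) =
      diagOne (Units.map (θ : K →* K) a) := by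
  ext i j
  fin_cases i <;> fin_cases j <;> simp [diagOne]

/-- The isomorphism of `GL₂(K)` that an automorphism of `K` induces. -/
def mapGL {K : Type*} [Field K] (θ : K ≃+* K) : GL (Fin 2) K ≃* GL (Fin 2) K :=
  Units.mapEquiv θ.mapMatrix.toMulEquiv

theorem mapGL_apply {K : Type*} [Field K] (θ : K ≃+* K) (g : GL (Fin 2) K) :
    mapGL θ g = Matrix.GeneralLinearGroup.map (θ : K →+* K) g := rfl

theorem mapGL_coe {K : Type*} [Field K] (θ : K ≃+* K) (s : SL(2, K)) :
    mapGL θ (s : GL (Fin 2) K) =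
      (Matrix.SpecialLinearGroup.map (θ : K →+* K) s : SL(2, K)) := by
  ext i j
  rfl

theorem map_surjective {K : Type*} [Field K] (θ : K ≃+* K) :
    Function.Surjective (Matrix.SpecialLinearGroup.map (n := Fin 2) (θ : K →+* K)) := fun s =>
  ⟨Matrix.SpecialLinearGroup.map (θ.symm : K →+* K) s, by
    ext i j
    exact θ.apply_symm_apply _⟩

/-- The matrix `s` conjugated by `diag(α, 1)`. -/
def conjSL {K : Type*} [Field K] (α : Kˣ) (s : SL(2, K)) : SL(2, K) :=
  ⟨!![s 0 0, α * s 0 1; (α⁻¹ : Kˣ) * s 1 0, s 1 1], by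
    have := s.det_coe
    rw [Matrix.det_fin_two] at this
    rw [Matrix.det_fin_two_of, mul_mul_mul_comm, Units.mul_inv, one_mul, this]⟩

theorem diagOne_mul_coe {K : Type*} [Field K] (α : Kˣ) (s : SL(2, K)) :
    diagOne α * (s : GL (Fin 2) K) = (conjSL α s : GL (Fin 2) K) * diagOne α := by
  ext i j
  rw [Units.val_mul, Units.val_mul]
  change ((diagOne α).1 * s.1) i j = ((conjSL α s).1 * (diagOne α).1) i j
  fin_cases i <;> fin_cases j <;>
    simp [diagOne, conjSL, Matrix.mul_apply, Fin.sum_univ_two, mul_comm]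

theorem diagOne_mul_diagOne_comm {K : Type*} [Field K] (α β : Kˣ) :
    diagOne α * diagOne β = diagOne β * diagOne α := by
  ext i j
  fin_cases i <;> fin_cases j <;>
    simp [diagOne, Matrix.mul_apply, Fin.sum_univ_two, mul_comm]

theorem conjSL_surjective {K : Type*} [Field K] (α : Kˣ) : Function.Surjective (conjSL α) :=
  fun s => ⟨conjSL α⁻¹ s, by
    ext i j
    fin_cases i <;> fin_cases j <;> simp [conjSL]⟩

/-! ### Dependence of the operators on ψ -/

section Shift

variable {p : ℕ} [Fact p.Prime] {K L : Type*} [Field K] [NormedField L]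
  [NormedAlgebra ℚ_[p] L] [FiniteDimensional ℚ_[p] L] [MeasurableSpace L] [BorelSpace L]
  [Algebra K L]

/-- If c ≠ 0, then c becomes α⁻¹c, and ψ(-(α⁻¹c)⁻¹ ·) is the shift by -c⁻¹ of ψ(α ·): Weil index,
measure and kernel coincide. If c = 0, only the product ab changes, to αab. -/
theorem weilSL_conjSL (ψ : AddChar K Circle) (α : Kˣ) (s : SL(2, K)) (Φ : L → ℂ) :
    weilSL p ψ (conjSL α s) Φ = weilSL p (ψ.mulShift (α : K)) s Φ := by
  funext x
  have h : (ψ.mulShift (α : K)).mulShift (-(s 1 0)⁻¹) =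
      ψ.mulShift (-(((α⁻¹ : Kˣ) : K) * s 1 0)⁻¹) := by
    ext y
    simp only [AddChar.mulShift_apply, mul_inv, Units.val_inv_eq_inv_val, inv_inv]
    ring_nf
  have h00 : conjSL α s 0 0 = s 0 0 := rfl
  have h01 : conjSL α s 0 1 = α * s 0 1 := rfl
  have h10 : conjSL α s 1 0 = (α⁻¹ : Kˣ) * s 1 0 := rfl
  have h11 : conjSL α s 1 1 = s 1 1 := rfl
  by_cases h0 : s 1 0 = 0
  · rw [weilSL, weilSL, if_pos h0, if_pos (by rw [h10, h0, mul_zero]), h00, h01,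
      AddChar.mulShift_apply]
    ring_nf
  · rw [weilSL, weilSL, if_neg h0,
      if_neg (by rw [h10]; exact mul_ne_zero (Units.ne_zero _) h0), h00, h10, h11, h]

theorem weilGL_conjSL (ω : Lˣ →* ℂˣ) (ψ : AddChar K Circle) (α : Kˣ) (l : Lˣ) (s : SL(2, K))
    (Φ : L → ℂ) : weilGL p ω ψ l (conjSL α s) Φ = weilGL p ω (ψ.mulShift (α : K)) l s Φ := by
  funext x
  rw [weilGL, weilGL, weilSL_conjSL]

end Shift

/-! ### Isomorphisms of the induced representations -/

section Rep

variable {p : ℕ} [Fact p.Prime] {K L : Type*} [NormedField K] [NormedAlgebra ℚ_[p] K]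
  [NormedField L] [NormedAlgebra ℚ_[p] L] [FiniteDimensional ℚ_[p] L]
  [Algebra K L] [IsScalarTower ℚ_[p] K L] [MeasurableSpace L] [BorelSpace L]
  [FiniteDimensional K L]

/-- With s quantified first, it can be reparametrized by a surjection of SL₂(K) before l and g are
touched. -/
theorem mem_space_iff {ω : Lˣ →* ℂˣ} {ψ : AddChar K Circle} (hψ : Continuous ψ)
    (f : GL (Fin 2) K → schwartz K ω) : f ∈ space p ω ψ hψ ↔
      ∀ (s : SL(2, K)) (l : Lˣ) (g : GL (Fin 2) K),
        (f (diagOne (Units.map (Algebra.norm K) l) * (s : GL (Fin 2) K) * g) : L → ℂ) =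
          weilGL p ω ψ l s (f g) :=
  forall_comm

/-- Left translation by `diag(α, 1)` identifies the dihedral representations formed with `ψ` and
`ψ(α ·)`. -/
def repEquivMulShift (ω : Lˣ →* ℂˣ) {ψ : AddChar K Circle} (hψ : Continuous ψ) (α : Kˣ)
    (hψα : Continuous (ψ.mulShift (α : K))) :
    (rep p ω ψ hψ).Equiv (rep p ω (ψ.mulShift (α : K)) hψα) :=
  let E := LinearEquiv.funCongrLeft ℂ (schwartz K ω) (Equiv.mulLeft (diagOne α))
  have hE : ∀ f, f ∈ space p ω ψ hψ ↔ E f ∈ space p ω (ψ.mulShift (α : K)) hψα := fun f => by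
    rw [mem_space_iff, mem_space_iff, (conjSL_surjective α).forall]
    refine forall_congr' fun s => forall_congr' fun l => ?_
    rw [(Equiv.mulLeft (diagOne α)).surjective.forall]
    refine forall_congr' fun g => ?_
    -- Moving diag(α, 1) to the left through the element of GL₂(K)₊ undoes the conjugation of s.
    have hg : diagOne (Units.map (Algebra.norm K) l) * (conjSL α s : GL (Fin 2) K) *
        (diagOne α * g) =
        diagOne α * (diagOne (Units.map (Algebra.norm K) l) * (s : GL (Fin 2) K) * g) := by
      rw [mul_assoc, ← mul_assoc _ (diagOne α), ← diagOne_mul_coe, ← mul_assoc, ← mul_assoc,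
        ← mul_assoc, ← mul_assoc, diagOne_mul_diagOne_comm]
    rw [Equiv.coe_mulLeft, hg, weilGL_conjSL]
    rfl
  .mk (E.ofSubmodules _ _ (by
    ext f
    rw [Submodule.mem_map_equiv, hE, LinearEquiv.apply_symm_apply])) fun g₀ => by
      ext f g : 3
      exact congrArg f.1 (mul_assoc (diagOne α) g g₀)

/-- Transport of the dihedral representation along an automorphism `σ` of `L` that extends an
automorphism `θ` of `K`. -/
def repEquivComp {θ : K ≃+* K} {σ : L ≃ₐ[ℚ_[p]] L}
    (h : ∀ x : K, σ (algebraMap K L x) = algebraMap K L (θ x)) (ω : Lˣ →* ℂˣ)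
    {ψ : AddChar K Circle} (hψ : Continuous ψ)
    (hψθ : Continuous (ψ.compAddMonoidHom (θ : K →+ K))) :
    Representation.Equiv
      ((rep p ω ψ hψ).comp (Matrix.GeneralLinearGroup.map (n := Fin 2) (θ : K →+* K)))
      (rep p (ω.comp (Units.map (σ : L →* L))) (ψ.compAddMonoidHom (θ : K →+ K)) hψθ) :=
  let E := (LinearEquiv.funCongrLeft ℂ (schwartz K ω) (mapGL θ).toEquiv).trans
    (LinearEquiv.piCongrRight fun _ => schwartzComp h ω)
  have hE : ∀ f, f ∈ space p ω ψ hψ ↔ E f ∈ space p (ω.comp (Units.map (σ : L →* L)))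
      (ψ.compAddMonoidHom (θ : K →+ K)) hψθ := fun f => by
    -- Writing s, l and g as images under θ, σ and θ matches the two families of conditions one by
    -- one; composition with σ loses nothing since σ is onto.
    rw [mem_space_iff, mem_space_iff, (map_surjective θ).forall]
    refine forall_congr' fun s => ?_
    rw [(Units.mapEquiv (σ : L ≃* L)).surjective.forall]
    refine forall_congr' fun l => ?_
    rw [(mapGL θ).surjective.forall]
    refine forall_congr' fun g => ?_
    have hE' : ∀ g, (E f g : L → ℂ) = (f (mapGL θ g) : L → ℂ) ∘ σ := fun g => rfl
    have hl : Units.map (Algebra.norm K) (Units.mapEquiv (σ : L ≃* L) l) =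
        Units.map (θ : K →* K) (Units.map (Algebra.norm K) l) :=
      Units.ext (algebraNorm_algEquiv h l)
    rw [hE', hE', map_mul, map_mul, mapGL_coe, mapGL_apply θ (diagOne _), map_diagOne, hl,
      ← weilGL_comp h, σ.surjective.injective_comp_right.eq_iff]
    rfl
  .mk (E.ofSubmodules _ _ (by
    ext f
    rw [Submodule.mem_map_equiv, hE, LinearEquiv.apply_symm_apply])) fun g₀ => by
      ext f g : 3
      exact congrArg (fun g => schwartzComp h ω (f.1 g)) (map_mul (mapGL θ) g g₀).symm

end Rep

end Dihedral
end

theorem proposition2p1 (p : ℕ) [Fact p.Prime] {F K L : Type*}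
    [Field F] [Algebra ℚ_[p] F] [FiniteDimensional ℚ_[p] F]
    [NormedField K] [NormedAlgebra ℚ_[p] K]
    [NormedField L] [NormedAlgebra ℚ_[p] L] [FiniteDimensional ℚ_[p] L]
    [MeasurableSpace L] [BorelSpace L]
    [Algebra F K] [IsScalarTower ℚ_[p] F K] [Algebra.IsQuadraticExtension F K]
    [Algebra K L] [IsScalarTower ℚ_[p] K L] [Algebra.IsQuadraticExtension K L]
    [Algebra F L] [IsScalarTower F K L]
    (θ : K ≃ₐ[F] K) (hθ : θ ≠ 1)
    (θt : L ≃ₐ[F] L) (hθt : ∀ x : K, θt (algebraMap K L x) = algebraMap K L (θ x))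
    (ω : Lˣ →* ℂˣ) (hω : Continuous ω)
    (ψ₁ ψ₂ : AddChar K Circle) (hψ₁ : Continuous ψ₁) (hψ₂ : Continuous ψ₂)
    (hψ₁' : ψ₁ ≠ 1) (hψ₂' : ψ₂ ≠ 1) :
    Nonempty
      (Representation.Equiv
        ((Dihedral.rep p ω ψ₁ hψ₁).comp
          (Matrix.GeneralLinearGroup.map (n := Fin 2) (θ : K →+* K)))
        (Dihedral.rep p (ω.comp (Units.map (θt : L →* L))) ψ₂ hψ₂)) := by
  have : IsScalarTower ℚ_[p] F L := IsScalarTower.of_algebraMap_eq fun x => by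
    rw [IsScalarTower.algebraMap_apply F K L, ← IsScalarTower.algebraMap_apply ℚ_[p] F K,
      ← IsScalarTower.algebraMap_apply ℚ_[p] K L]
  have : FiniteDimensional ℚ_[p] K := FiniteDimensional.trans ℚ_[p] F K
  have : ProperSpace K := FiniteDimensional.proper ℚ_[p] K
  have : IsUltrametricDist K :=
    IsUltrametricDist.isUltrametricDist_of_forall_norm_natCast_le_one fun n => by
      rw [← map_natCast (algebraMap ℚ_[p] K), norm_algebraMap']
      exact IsUltrametricDist.norm_natCast_le_one ℚ_[p] n
  have hK : ∃ x : K, 1 < ‖x‖ := by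
    obtain ⟨x, hx⟩ := NormedField.exists_one_lt_norm ℚ_[p]
    exact ⟨algebraMap ℚ_[p] K x, by rwa [norm_algebraMap']⟩
  have hcont : Continuous θ :=
    (Dihedral.algEquivHomeomorph (θ.restrictScalars ℚ_[p])).continuous
  have hψθ : Continuous (ψ₁.compAddMonoidHom ((θ : K ≃+* K) : K →+ K)) := hψ₁.comp hcont
  have hψθ' : ψ₁.compAddMonoidHom ((θ : K ≃+* K) : K →+ K) ≠ 1 := fun h =>
    hψ₁' (DFunLike.ext _ _ fun x => by
      simpa using DFunLike.congr_fun h (θ.symm x))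
  -- Transport along `θt` produces the character ψ₁ ∘ θ; this α leads from it to ψ₂.
  obtain ⟨α, hα⟩ := AddChar.exists_eq_mulShift hK hψθ hψθ' hψ₂
  have hα0 : α ≠ 0 := by
    rintro rfl
    exact hψ₂' (by rw [hα, AddChar.mulShift_zero])
  subst hα
  exact ⟨(Dihedral.repEquivComp (θ := (θ : K ≃+* K)) (σ := θt.restrictScalars ℚ_[p])
    hθt ω hψ₁ hψθ).trans
      (Dihedral.repEquivMulShift (ω.comp (Units.map (θt : L →* L))) hψθ (Units.mk0 α hα0) hψ₂)⟩
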